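/- Let $I=[-1,1]$ and let $\mathcal F_{\mathrm{INV}}$ be the set of all maps $f:I^2\to I^2$ such that for every $y\in I^2$ there is exactly one $x\in I^2$ with $f(x)=y$, and such that $f$ is bi-Lipschitz: for some $L>0$, $L^{-1}\|x-x'\|_2\le\|f(x)-f(x')\|_2\le L\|x-x'\|_2$ for all $x,x'\in I^2$. Let $\sigma>0$ and let $P_X$ be a probability measure on $I^2$ that has a density with respect to Lebesgue measure and whose support is $I^2$. For $f_*\in\mathcal F_{\mathrm{INV}}$ and $n\ge 1$ let $\mathbb P_{f_*}$ be the law of a sample $\mathcal D_n=\{(X_i,Y_i)\}_{i=1}^n$ of i.i.d. observations $$Y_i=f_*(X_i)+\varepsilon_i,\qquad X_i\sim P_X,\qquad \varepsilon_i\sim N_2(0,\sigma^2 I_2),$$ with $X_i$ and $\varepsilon_i$ independent. For $g=(g_1,g_2):I^2\to\mathbb R^2$ put $\mathsf R(g,f_*)=\sum_{j=1}^2\int_{I^2}|g_j-f_{*,j}|^2\,dP_X\in[0,\infty]$. With $d=2$, there is a constant $C_*>0$, depending only on $\sigma$ and $P_X$, such that for every $n\ge 1$ $$\inf_{\bar f_n}\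 \sup_{f_*\in\mathcal F_{\mathrm{INV}}}\ \mathbb P_{f_*}\!\left(\mathsf R(\bar f_n,f_*)\ \ge\ C_*\,n^{-2/(2+d)}\right)\ >\ \frac12 ,$$ where the infimum is over all measurable estimators $\bar f_n$, that is, all jointly measurable maps $(\mathcal D_n,x)\mapsto\bar f_n(x)\in\mathbb R^2$, $x\in I^2$. -/

import Mathlib

open MeasureTheory ProbabilityTheory
open scoped ENNReal

namespace InvertibleRegression

/-- The Euclidean plane `ℝ²`. -/
abbrev Plane : Type := EuclideanSpace ℝ (Fin 2)

/-- The square `I² = [-1,1]²` as a set of points of the plane. -/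
def squareSet : Set Plane := {x | ∀ j, x j ∈ Set.Icc (-1 : ℝ) 1}

/-- The square `I²` as a type, with the Euclidean distance and the Borel σ-algebra inherited
from the plane. -/
abbrev Square : Type := squareSet

/-- Lebesgue measure on the square. -/
noncomputable def lebesgueSquare : Measure Square :=
  (volume : Measure Plane).comap Subtype.val

/-- `f` is bi-Lipschitz for the Euclidean distance. -/
def IsBiLipschitz (f : Square → Square) : Prop :=
  ∃ L : ℝ, 0 < L ∧ ∀ x x' : Square,
    L⁻¹ * dist x x' ≤ dist (f x) (f x') ∧ dist (f x) (f x') ≤ L * dist x x'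

/-- The class of invertible bi-Lipschitz maps of the square to itself. -/
def invLip : Set (Square → Square) :=
  {f | (∀ y, ∃! x, f x = y) ∧ IsBiLipschitz f}

/-- The noise distribution `N₂(0, σ² I₂)`. -/
noncomputable def noise (σ : ℝ) : Measure Plane :=
  multivariateGaussian 0 (σ ^ 2 • (1 : Matrix (Fin 2) (Fin 2) ℝ))

/-- The law of one observation `(X, Y)`, where `Y = f(X) + ε`, `X ∼ PX`, `ε ∼ N₂(0, σ² I₂)`,
with `X` and `ε` independent. -/
noncomputable def obsLaw (PX : Measure Square) (σ : ℝ) (f : Square → Square) :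
    Measure (Square × Plane) :=
  (PX.prod (noise σ)).map (fun p => (p.1, (f p.1 : Plane) + p.2))

/-- The law of the sample `D_n` of `n` independent observations with true function `f`. -/
noncomputable def sampleLaw (PX : Measure Square) (σ : ℝ) (n : ℕ) (f : Square → Square) :
    Measure (Fin n → Square × Plane) :=
  Measure.pi (fun _ => obsLaw PX σ f)

/-- Measurable estimators: jointly measurable maps that send a sample `D` and a point `x` of the
square to the value at `x` of the estimated function. -/
def Estimator (n : ℕ) : Type :=
  {g : (Fin n → Square × Plane) → Square → Plane // Measurable (Function.uncurry g)}

/-- The ordinary risk `∑ⱼ ∫ |gⱼ - fⱼ|² dPX`, with values in `[0, ∞]`. -/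
noncomputable def risk (PX : Measure Square) (g : Square → Plane) (f : Square → Square) : ℝ≥0∞ :=
  ∑ j : Fin 2, ∫⁻ x, ENNReal.ofReal (|g x j - (f x : Plane) j| ^ 2) ∂PX

end InvertibleRegression

/-! The rate already appears among small horizontal perturbations of the identity. Cut the square
into `m ^ 2` cells and, for each selection `θ` of cells, push points to the right by half a pyramid
of height `1 / m` on the selected ones. The displacement has Lipschitz constant `1 / 2` and vanishes
on the vertical edges, so the map is a bi-Lipschitz bijection (`cellShift_mem_invLip`). Absolute
continuity of `PX` supplies a set `G` of order `m ^ 2` cells whose interiors have mass of order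
`m⁻²` (`exists_good_cells`), so the squared `L²(PX)` distance of two maps is at least of order `m⁻⁴`
times the Hamming distance of their labels (`hammingDist_mul_le`).

All maps are compared with the identity. A sample for which the estimator is close to both `θ` and
`θ'` forces these labels to be close, and Hamming balls of radius `|G| / 4` contain at most a `(9 /
10) ^ |G|` fraction of the cube. Averaging over `θ` under the identity law yields a label whose
success event has probability at most `(9 / 10) ^ |G|` (`exists_measure_le_of_hammingDist`).
Cauchy–Schwarz transfers this to the law of that label at the cost of the second moment of the
likelihood ratio, at most `exp (n / (4 m² σ²))` (`pi_withDensity_sq_le`). With `m` a large multiple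
of `n ^ (1 / 4)` the cost is beaten, the success probability is at most `1 / 4`, and the separation
has order `m⁻²`, that is `n ^ (-1 / 2)`. -/

namespace InvertibleRegression

/-! ### Gaussian shifts -/

/-- The density of `N(s, v)` with respect to `N(0, v)`. -/
noncomputable def gaussianTilt (v s a : ℝ) : ℝ≥0∞ :=
  ENNReal.ofReal (Real.exp (s * a / v - s ^ 2 / (2 * v)))

lemma measurable_gaussianTilt (v : ℝ) : Measurable fun p : ℝ × ℝ => gaussianTilt v p.1 p.2 := by
  unfold gaussianTilt
  fun_prop

/-- The Cameron–Martin formula on the real line. -/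
lemma lintegral_gaussianReal_add {v : NNReal} (hv : v ≠ 0) (s : ℝ) {H : ℝ → ℝ≥0∞}
    (hH : Measurable H) :
    ∫⁻ a, H (a + s) ∂gaussianReal 0 v = ∫⁻ a, gaussianTilt v s a * H a ∂gaussianReal 0 v := by
  have ht : Measurable (gaussianTilt v s) := (measurable_gaussianTilt v).comp measurable_prodMk_left
  have htH : Measurable fun a => gaussianTilt v s a * H a := ht.mul hH
  rw [← lintegral_map hH (measurable_add_const s), gaussianReal_map_add_const, zero_add,
    gaussianReal_of_var_ne_zero _ hv, gaussianReal_of_var_ne_zero _ hv,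
    lintegral_withDensity_eq_lintegral_mul _ (measurable_gaussianPDF _ _) hH,
    lintegral_withDensity_eq_lintegral_mul _ (measurable_gaussianPDF _ _) htH]
  refine lintegral_congr fun a => ?_
  simp only [Pi.mul_apply]
  rw [← mul_assoc]
  congr 1
  rw [gaussianPDF, gaussianPDF, gaussianTilt, ← ENNReal.ofReal_mul (gaussianPDFReal_nonneg _ _ _),
    gaussianPDFReal, gaussianPDFReal, mul_assoc (Real.sqrt (2 * Real.pi * v))⁻¹, ← Real.exp_add]
  have : (v : ℝ) ≠ 0 := by exact_mod_cast hv
  congr 3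
  field_simp
  ring

lemma lintegral_gaussianTilt {v : NNReal} (hv : v ≠ 0) (s : ℝ) :
    ∫⁻ a, gaussianTilt v s a ∂gaussianReal 0 v = 1 := by
  have := lintegral_gaussianReal_add hv s (H := fun _ => 1) measurable_const
  simpa using this.symm

/-- Completing the square turns the squared tilt by `s` into a constant times the tilt by `2 * s`,
which has integral one. -/
lemma lintegral_gaussianTilt_sq {v : NNReal} (hv : v ≠ 0) (s : ℝ) :
    ∫⁻ a, gaussianTilt v s a ^ 2 ∂gaussianReal 0 v = ENNReal.ofReal (Real.exp (s ^ 2 / v)) := by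
  have hv' : (v : ℝ) ≠ 0 := by exact_mod_cast hv
  have h : ∀ a, gaussianTilt v s a ^ 2
      = ENNReal.ofReal (Real.exp (s ^ 2 / v)) * gaussianTilt v (2 * s) a := by
    intro a
    rw [gaussianTilt, gaussianTilt, ← ENNReal.ofReal_pow (Real.exp_pos _).le,
      ← ENNReal.ofReal_mul (Real.exp_pos _).le, ← Real.exp_add, ← Real.exp_nat_mul]
    congr 2
    field_simp
    push_cast
    ring
  have ht : Measurable (gaussianTilt v (2 * s)) :=
    (measurable_gaussianTilt v).comp measurable_prodMk_left
  simp_rw [h]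
  rw [lintegral_const_mul _ ht, lintegral_gaussianTilt hv, mul_one]

instance isProbabilityMeasure_noise (σ : ℝ) : IsProbabilityMeasure (noise σ) := by
  unfold noise
  infer_instance

lemma noise_eq_map_pi (σ : ℝ) :
    noise σ = (Measure.pi fun _ : Fin 2 => gaussianReal 0 (σ ^ 2).toNNReal).map
      (WithLp.toLp 2) := by
  have hS : (σ ^ 2 • (1 : Matrix (Fin 2) (Fin 2) ℝ)).PosSemidef :=
    Matrix.PosSemidef.one.smul (sq_nonneg σ)
  apply Measure.ext_of_charFun (E := Plane)
  ext t
  rw [noise, charFun_multivariateGaussian hS, charFun_pi]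
  simp_rw [charFun_gaussianReal]
  rw [← Complex.exp_sum]
  congr 1
  simp [Fin.sum_univ_two, dotProduct, Matrix.smul_mulVec, max_eq_left (sq_nonneg σ)]
  ring

lemma noise_eq_map_prod (σ : ℝ) :
    noise σ = ((gaussianReal 0 (σ ^ 2).toNNReal).prod (gaussianReal 0 (σ ^ 2).toNNReal)).map
      (fun p => !₂[p.1, p.2]) := by
  rw [noise_eq_map_pi, ← (measurePreserving_finTwoArrow
    (gaussianReal 0 (σ ^ 2).toNNReal)).symm.map_eq, Measure.map_map]
  · rfl
  · fun_prop
  · exact MeasurableEquiv.measurable _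

lemma measurable_toPlane : Measurable fun p : ℝ × ℝ => (!₂[p.1, p.2] : Plane) := by
  refine (WithLp.measurable_toLp 2 _).comp (measurable_pi_iff.2 fun j => ?_)
  fin_cases j
  · exact measurable_fst
  · exact measurable_snd

lemma lintegral_noise (σ : ℝ) {F : Plane → ℝ≥0∞} (hF : Measurable F) :
    ∫⁻ e, F e ∂noise σ = ∫⁻ b, ∫⁻ a, F !₂[a, b] ∂gaussianReal 0 (σ ^ 2).toNNReal
      ∂gaussianReal 0 (σ ^ 2).toNNReal := by
  have h : Measurable fun p : ℝ × ℝ => F !₂[p.1, p.2] := hF.comp measurable_toPlane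
  rw [noise_eq_map_prod, lintegral_map hF measurable_toPlane, lintegral_prod_symm' _ h]

/-- The noise coordinates are independent and only the first is shifted, so the one-dimensional
formula applies for each fixed second coordinate. -/
lemma lintegral_noise_add {σ : ℝ} (hσ : 0 < σ) (s : ℝ) {F : Plane → ℝ≥0∞} (hF : Measurable F) :
    ∫⁻ e, F (!₂[s, 0] + e) ∂noise σ = ∫⁻ e, gaussianTilt (σ ^ 2) s (e 0) * F e ∂noise σ := by
  have hv : (σ ^ 2).toNNReal ≠ 0 := by simpa using hσ.ne'
  have hv' : (((σ ^ 2).toNNReal : NNReal) : ℝ) = σ ^ 2 := Real.coe_toNNReal _ (sq_nonneg σ)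
  have ht : Measurable (gaussianTilt (σ ^ 2) s) :=
    (measurable_gaussianTilt _).comp measurable_prodMk_left
  rw [lintegral_noise σ (F := fun e => F (!₂[s, 0] + e)) (by fun_prop), lintegral_noise σ (by fun_prop)]
  refine lintegral_congr fun b => ?_
  have h := lintegral_gaussianReal_add hv s (H := fun a => F !₂[a, b])
    (hF.comp (measurable_toPlane.comp measurable_prodMk_right))
  rw [hv'] at h
  simp only [Matrix.cons_val_zero]
  rw [← h]
  refine lintegral_congr fun a => ?_
  congr 1
  ext j
  fin_cases j <;> simp [add_comm]

lemma lintegral_noise_gaussianTilt_sq {σ : ℝ} (hσ : 0 < σ) (s : ℝ) :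
    ∫⁻ e, gaussianTilt (σ ^ 2) s (e 0) ^ 2 ∂noise σ
      = ENNReal.ofReal (Real.exp (s ^ 2 / σ ^ 2)) := by
  have hv : (σ ^ 2).toNNReal ≠ 0 := by simpa using hσ.ne'
  have hv' : (((σ ^ 2).toNNReal : NNReal) : ℝ) = σ ^ 2 := Real.coe_toNNReal _ (sq_nonneg σ)
  have ht : Measurable (gaussianTilt (σ ^ 2) s) :=
    (measurable_gaussianTilt _).comp measurable_prodMk_left
  rw [lintegral_noise σ (by fun_prop)]
  have h := lintegral_gaussianTilt_sq hv s
  rw [hv'] at h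
  simp [h]

/-! ### Likelihood ratio of one observation -/

/-- The likelihood ratio of one observation between the horizontal displacement `u` and the
identity. -/
noncomputable def likelihoodRatio (σ : ℝ) (u : Square → ℝ) (p : Square × Plane) : ℝ≥0∞ :=
  gaussianTilt (σ ^ 2) (u p.1) (p.2 0 - (p.1 : Plane) 0)

lemma measurable_likelihoodRatio (σ : ℝ) {u : Square → ℝ} (hu : Measurable u) :
    Measurable (likelihoodRatio σ u) := by
  have h : Measurable fun p : Square × Plane => (u p.1, p.2 0 - (p.1 : Plane) 0) := by fun_prop
  exact (measurable_gaussianTilt _).comp h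

lemma lintegral_obsLaw (PX : Measure Square) (σ : ℝ) {f : Square → Square} (hf : Measurable f)
    {F : Square × Plane → ℝ≥0∞} (hF : Measurable F) :
    ∫⁻ p, F p ∂obsLaw PX σ f = ∫⁻ x, ∫⁻ e, F (x, (f x : Plane) + e) ∂noise σ ∂PX := by
  have h : Measurable fun p : Square × Plane => (p.1, (f p.1 : Plane) + p.2) := by fun_prop
  have hFh : Measurable fun p : Square × Plane => F (p.1, (f p.1 : Plane) + p.2) := hF.comp h
  rw [obsLaw, lintegral_map hF h, lintegral_prod _ hFh.aemeasurable]

lemma isProbabilityMeasure_obsLaw (PX : Measure Square) [IsProbabilityMeasure PX] (σ : ℝ)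
    {f : Square → Square} (hf : Measurable f) : IsProbabilityMeasure (obsLaw PX σ f) :=
  Measure.isProbabilityMeasure_map (by fun_prop)

lemma obsLaw_eq_withDensity (PX : Measure Square) {σ : ℝ} (hσ : 0 < σ) {u : Square → ℝ}
    (hu : Measurable u) {f : Square → Square} (hf : Measurable f)
    (hfu : ∀ x, (f x : Plane) = (x : Plane) + !₂[u x, 0]) :
    obsLaw PX σ f = (obsLaw PX σ id).withDensity (likelihoodRatio σ u) := by
  have hr := measurable_likelihoodRatio σ hu
  refine Measure.ext_of_lintegral _ fun F hF => ?_
  rw [lintegral_withDensity_eq_lintegral_mul _ hr hF, lintegral_obsLaw PX σ hf hF,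
    lintegral_obsLaw PX σ measurable_id (hr.mul hF)]
  refine lintegral_congr fun x => ?_
  have h := lintegral_noise_add hσ (u x) (F := fun e => F (x, (x : Plane) + e)) (by fun_prop)
  simp only [hfu, add_assoc, h]
  refine lintegral_congr fun e => ?_
  simp [likelihoodRatio]

lemma lintegral_likelihoodRatio_sq_le (PX : Measure Square) [IsProbabilityMeasure PX] {σ : ℝ}
    (hσ : 0 < σ) {u : Square → ℝ} (hu : Measurable u) {b : ℝ} (hb : ∀ x, |u x| ≤ b) :
    ∫⁻ p, likelihoodRatio σ u p ^ 2 ∂obsLaw PX σ id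
      ≤ ENNReal.ofReal (Real.exp (b ^ 2 / σ ^ 2)) := by
  have hr := measurable_likelihoodRatio σ hu
  rw [lintegral_obsLaw PX σ measurable_id (hr.pow_const 2)]
  have h : ∀ x, ∫⁻ e, likelihoodRatio σ u (x, ((id x : Square) : Plane) + e) ^ 2 ∂noise σ
      ≤ ENNReal.ofReal (Real.exp (b ^ 2 / σ ^ 2)) := by
    intro x
    have h1 := lintegral_noise_gaussianTilt_sq hσ (u x)
    simp only [likelihoodRatio, id, PiLp.add_apply, add_sub_cancel_left, h1]
    have := sq_le_sq' (abs_le.1 (hb x)).1 (abs_le.1 (hb x)).2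
    gcongr
  calc _ ≤ ∫⁻ _, ENNReal.ofReal (Real.exp (b ^ 2 / σ ^ 2)) ∂PX := lintegral_mono h
    _ = _ := by simp

/-! ### Change of measure for samples -/

lemma lintegral_pi_prod {n : ℕ} {Ω : Type*} [MeasurableSpace Ω] (μ : Measure Ω)
    [IsProbabilityMeasure μ] {r : Fin n → Ω → ℝ≥0∞} (hr : ∀ i, Measurable (r i)) :
    ∫⁻ D : Fin n → Ω, ∏ i, r i (D i) ∂Measure.pi (fun _ => μ) = ∏ i, ∫⁻ x, r i x ∂μ := by
  have h := lintegral_prod_eq_prod_lintegral_of_indepFun Finset.univ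
    (fun i (D : Fin n → Ω) => r i (D i))
    (iIndepFun_pi (μ := fun _ : Fin n => μ) fun i => (hr i).aemeasurable)
    (fun i => (hr i).comp (measurable_pi_apply i))
  rw [h]
  exact Finset.prod_congr rfl fun i _ =>
    (measurePreserving_eval (fun _ : Fin n => μ) i).lintegral_comp (hr i)

lemma pi_withDensity {n : ℕ} {Ω : Type*} [MeasurableSpace Ω] (μ : Measure Ω)
    [IsProbabilityMeasure μ] {r : Ω → ℝ≥0∞} (hr : Measurable r)
    [IsProbabilityMeasure (μ.withDensity r)] :
    Measure.pi (fun _ : Fin n => μ.withDensity r)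
      = (Measure.pi fun _ : Fin n => μ).withDensity fun D => ∏ i, r (D i) := by
  refine Measure.pi_eq fun s hs => ?_
  rw [withDensity_apply _ (MeasurableSet.univ_pi hs), ← lintegral_indicator (MeasurableSet.univ_pi hs)]
  have h : ∀ D : Fin n → Ω, (Set.univ.pi s).indicator (fun D => ∏ i, r (D i)) D
      = ∏ i, (s i).indicator r (D i) := by
    intro D
    by_cases hD : D ∈ Set.univ.pi s
    · rw [Set.indicator_of_mem hD]
      exact Finset.prod_congr rfl fun i _ =>
        (Set.indicator_of_mem (hD i (Set.mem_univ i)) r).symm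
    · rw [Set.indicator_of_notMem hD]
      simp only [Set.mem_univ_pi, not_forall] at hD
      obtain ⟨i, hi⟩ := hD
      exact (Finset.prod_eq_zero (Finset.mem_univ i) (Set.indicator_of_notMem hi r)).symm
  simp_rw [h]
  rw [lintegral_pi_prod μ fun i => hr.indicator (hs i)]
  refine Finset.prod_congr rfl fun i _ => ?_
  rw [withDensity_apply _ (hs i), lintegral_indicator (hs i)]

/-- Change of measure for product measures through the second moment of the likelihood ratio. -/
lemma pi_withDensity_sq_le {n : ℕ} {Ω : Type*} [MeasurableSpace Ω] (μ : Measure Ω)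
    [IsProbabilityMeasure μ] {r : Ω → ℝ≥0∞} (hr : Measurable r)
    [IsProbabilityMeasure (μ.withDensity r)] {B : ℝ≥0∞} (hB : ∫⁻ x, r x ^ 2 ∂μ ≤ B)
    {A : Set (Fin n → Ω)} (hA : MeasurableSet A) :
    Measure.pi (fun _ : Fin n => μ.withDensity r) A ^ 2
      ≤ B ^ n * Measure.pi (fun _ : Fin n => μ) A := by
  have hR : Measurable fun D : Fin n → Ω => ∏ i, r (D i) := by fun_prop
  have h1 : Measurable (A.indicator (1 : (Fin n → Ω) → ℝ≥0∞)) := measurable_one.indicator hA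
  -- Cauchy–Schwarz for the product likelihood ratio against the indicator of `A`.
  have h := ENNReal.lintegral_mul_le_Lp_mul_Lq (Measure.pi fun _ : Fin n => μ)
    Real.HolderConjugate.two_two hR.aemeasurable h1.aemeasurable
  have e1 : Measure.pi (fun _ : Fin n => μ.withDensity r) A
      = ∫⁻ D : Fin n → Ω, (∏ i, r (D i)) * A.indicator 1 D
        ∂Measure.pi fun _ : Fin n => μ := by
    rw [pi_withDensity μ hr, withDensity_apply _ hA, ← lintegral_indicator hA]
    refine lintegral_congr fun D => ?_
    by_cases hD : D ∈ A <;> simp [hD]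
  have e2 : ∫⁻ D : Fin n → Ω, (∏ i, r (D i)) ^ (2 : ℝ) ∂Measure.pi (fun _ : Fin n => μ)
      ≤ B ^ n := by
    have : ∀ D : Fin n → Ω, (∏ i, r (D i)) ^ (2 : ℝ) = ∏ i, r (D i) ^ 2 := by
      intro D
      rw [ENNReal.rpow_two, Finset.prod_pow]
    simp_rw [this]
    rw [lintegral_pi_prod μ (r := fun _ x => r x ^ 2) fun _ => hr.pow_const 2]
    simpa using pow_le_pow_left' hB n
  have e3 : ∫⁻ D, (A.indicator (1 : (Fin n → Ω) → ℝ≥0∞) D) ^ (2 : ℝ)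
      ∂Measure.pi (fun _ : Fin n => μ) = Measure.pi (fun _ : Fin n => μ) A := by
    rw [← lintegral_indicator_one hA]
    refine lintegral_congr fun D => ?_
    by_cases hD : D ∈ A <;> simp [hD]
  simp only [Pi.mul_apply] at h
  rw [← e1, e3] at h
  have hs : ∀ x : ℝ≥0∞, (x ^ (1 / 2 : ℝ)) ^ 2 = x := by
    intro x
    rw [← ENNReal.rpow_natCast, ← ENNReal.rpow_mul]
    norm_num
  calc _ ≤ _ := pow_le_pow_left' h 2
    _ ≤ _ := by
      rw [mul_pow, hs, hs]
      gcongr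

/-! ### Packing in the Hamming cube -/

section Hamming

variable {ι : Type*} [Fintype ι] [DecidableEq ι]

lemma sum_pow_hammingDist (θ₀ : ι → Bool) (b : ℝ) :
    ∑ θ : ι → Bool, b ^ hammingDist θ θ₀ = (1 + b) ^ Fintype.card ι := by
  classical
  have h : ∀ θ : ι → Bool, b ^ hammingDist θ θ₀ = ∏ i, if θ i ≠ θ₀ i then b else 1 := by
    intro θ
    rw [Finset.prod_ite, Finset.prod_const_one, mul_one, Finset.prod_const]
    rfl
  simp_rw [h]
  rw [← Fintype.piFinset_univ, Finset.sum_prod_piFinset Finset.univ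
    (fun i t => if t ≠ θ₀ i then b else 1)]
  have : ∀ i, ∑ t : Bool, (if t ≠ θ₀ i then b else 1) = 1 + b := by
    intro i
    cases θ₀ i <;> simp [add_comm]
  rw [Finset.prod_congr rfl fun i _ => this i, Finset.prod_const, Finset.card_univ]

/-- Chernoff bound: with weight `(2 / 3) ^ 4` per disagreement, each label in the ball weighs at
least `(2 / 3) ^ k`, while the whole cube weighs `(97 / 81) ^ k`. The quotient `97 / 54` is below `9
/ 5`. -/
lemma card_hammingDist_le (θ₀ : ι → Bool) :
    ((Finset.univ.filter fun θ : ι → Bool => 4 * hammingDist θ θ₀ ≤ Fintype.card ι).card : ℝ)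
      ≤ (9 / 10) ^ Fintype.card ι * 2 ^ Fintype.card ι := by
  set k := Fintype.card ι
  have h1 : ∑ θ ∈ Finset.univ.filter (fun θ : ι → Bool => 4 * hammingDist θ θ₀ ≤ k),
      ((2 / 3 : ℝ)) ^ k ≤ (1 + (2 / 3) ^ 4 : ℝ) ^ k := by
    rw [← sum_pow_hammingDist θ₀]
    calc _ ≤ ∑ θ ∈ Finset.univ.filter (fun θ : ι → Bool => 4 * hammingDist θ θ₀ ≤ k),
          ((2 / 3 : ℝ) ^ 4) ^ hammingDist θ θ₀ := by
          refine Finset.sum_le_sum fun θ hθ => ?_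
          rw [← pow_mul]
          exact pow_le_pow_of_le_one (by norm_num) (by norm_num) (Finset.mem_filter.1 hθ).2
      _ ≤ _ := Finset.sum_le_sum_of_subset_of_nonneg (Finset.filter_subset _ _)
          fun _ _ _ => by positivity
  rw [Finset.sum_const, nsmul_eq_mul, ← le_div_iff₀ (by positivity), ← div_pow] at h1
  refine h1.trans ?_
  rw [← mul_pow]
  exact pow_le_pow_left₀ (by norm_num) (by norm_num) k

/-- If every point belongs only to sets whose labels are close to each other, one of the sets has
exponentially small measure. -/
lemma exists_measure_le_of_hammingDist {Ω : Type*} [MeasurableSpace Ω] (μ : Measure Ω)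
    [IsProbabilityMeasure μ] (A : (ι → Bool) → Set Ω) (hA : ∀ θ, MeasurableSet (A θ))
    (hsep : ∀ ω θ θ', ω ∈ A θ → ω ∈ A θ' → 4 * hammingDist θ θ' ≤ Fintype.card ι) :
    ∃ θ, μ (A θ) ≤ ENNReal.ofReal ((9 / 10) ^ Fintype.card ι) := by
  classical
  by_contra! hcon
  set k := Fintype.card ι
  have h1 : ∑ θ, ∫⁻ ω, (A θ).indicator 1 ω ∂μ
      ≤ ENNReal.ofReal ((9 / 10) ^ k) * 2 ^ k := by
    rw [← lintegral_finsetSum _ fun θ _ => measurable_one.indicator (hA θ)]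
    calc _ ≤ ∫⁻ _, ENNReal.ofReal ((9 / 10) ^ k) * 2 ^ k ∂μ := by
          refine lintegral_mono fun ω => ?_
          by_cases hω : ∃ θ, ω ∈ A θ
          -- Any one label whose set contains `ω` serves as centre: all the others lie in the ball
          -- around it.
          · obtain ⟨θ₀, hθ₀⟩ := hω
            have h2 : ∑ θ, (A θ).indicator (1 : Ω → ℝ≥0∞) ω
                = ((Finset.univ.filter fun θ => ω ∈ A θ).card : ℝ≥0∞) := by
              simp [Set.indicator_apply]
            have h3 := card_hammingDist_le θ₀
            have h4 : (Finset.univ.filter fun θ => ω ∈ A θ).card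
                ≤ (Finset.univ.filter fun θ : ι → Bool => 4 * hammingDist θ θ₀ ≤ k).card := by
              refine Finset.card_le_card fun θ hθ => ?_
              simp only [Finset.mem_filter, Finset.mem_univ, true_and] at hθ ⊢
              exact hsep ω θ θ₀ hθ hθ₀
            rw [h2]
            have h5 : ENNReal.ofReal ((9 / 10) ^ k) * 2 ^ k
                = ENNReal.ofReal ((9 / 10) ^ k * 2 ^ k) := by
              rw [ENNReal.ofReal_mul (by positivity), ENNReal.ofReal_pow (p := 2) (by norm_num)]
              norm_num
            rw [h5, ← ENNReal.ofReal_natCast]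
            exact ENNReal.ofReal_le_ofReal ((Nat.cast_le.2 h4).trans h3)
          · push Not at hω
            simp [hω]
      _ = _ := by simp
  have h6 : ENNReal.ofReal ((9 / 10) ^ k) * 2 ^ k < ∑ θ, ∫⁻ ω, (A θ).indicator 1 ω ∂μ := by
    calc ENNReal.ofReal ((9 / 10) ^ k) * 2 ^ k
        = ∑ _θ : ι → Bool, ENNReal.ofReal ((9 / 10) ^ k) := by
          simp [k, mul_comm]
      _ < _ := by
          refine ENNReal.sum_lt_sum_of_nonempty Finset.univ_nonempty fun θ _ => ?_
          rw [lintegral_indicator_one (hA θ)]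
          exact hcon θ
  exact absurd h1 (not_le.2 h6)

end Hamming

/-! ### Horizontal shifts as invertible maps -/

lemma abs_coord_sub_le (x y : Square) (j : Fin 2) : |x.1 j - y.1 j| ≤ dist x y := by
  rw [Subtype.dist_eq, ← Real.dist_eq]
  exact PiLp.dist_apply_le x.1 y.1 j

lemma horizontalShift_mem {u : Square → ℝ} (hu0 : ∀ x, 0 ≤ u x)
    (hu1 : ∀ x, u x ≤ 1 - |x.1 0|) (x : Square) : x.1 + !₂[u x, 0] ∈ squareSet := by
  intro j
  have h0 := hu0 x
  have h1 := hu1 x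
  have h2 := x.2 0
  have h3 := x.2 1
  have h4 := le_abs_self (x.1 0)
  fin_cases j
  · simp only [Fin.zero_eta, PiLp.add_apply, Matrix.cons_val_zero]
    exact ⟨by linarith [h2.1], by linarith⟩
  · simpa using h3

/-- The self-map of the square that moves each point to the right by `u`. -/
noncomputable def horizontalShift (u : Square → ℝ) (hu0 : ∀ x, 0 ≤ u x)
    (hu1 : ∀ x, u x ≤ 1 - |x.1 0|) (x : Square) : Square :=
  ⟨x.1 + !₂[u x, 0], horizontalShift_mem hu0 hu1 x⟩

section Shift

variable {u : Square → ℝ} (hu0 : ∀ x, 0 ≤ u x) (hu1 : ∀ x, u x ≤ 1 - |x.1 0|)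

lemma norm_toPlane_left (a : ℝ) : ‖(!₂[a, 0] : Plane)‖ = |a| := by
  simp [EuclideanSpace.norm_eq, Real.sqrt_sq_eq_abs]

/-- The triangle inequality around the identity gives distance ratios between `1 / 2` and `3 / 2`.
-/
lemma isBiLipschitz_horizontalShift (hlip : ∀ x y, |u x - u y| ≤ 1 / 2 * dist x y) :
    IsBiLipschitz (horizontalShift u hu0 hu1) := by
  refine ⟨2, two_pos, fun x y => ?_⟩
  have h := hlip x y
  have he : (horizontalShift u hu0 hu1 x).1 - (horizontalShift u hu0 hu1 y).1
      = (x.1 - y.1) + !₂[u x - u y, 0] := by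
    ext j
    fin_cases j
    · simp [horizontalShift]
      ring
    · simp [horizontalShift]
  have hd : dist x y = ‖x.1 - y.1‖ := by rw [Subtype.dist_eq, dist_eq_norm]
  rw [Subtype.dist_eq (horizontalShift u hu0 hu1 x), dist_eq_norm, he]
  have h1 := norm_add_le (x.1 - y.1) !₂[u x - u y, 0]
  have h2 := norm_sub_norm_le (x.1 - y.1) (-!₂[u x - u y, 0])
  rw [norm_neg, sub_neg_eq_add] at h2
  rw [norm_toPlane_left] at h1 h2
  have h3 := norm_nonneg (x.1 - y.1)
  rw [hd] at h ⊢
  constructor <;> linarith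

/-- Each horizontal segment is mapped into itself with its endpoints fixed, so the intermediate
value theorem applies on it. -/
lemma horizontalShift_surjective (hu : Continuous u) :
    Function.Surjective (horizontalShift u hu0 hu1) := by
  intro y
  let p : Set.Icc (-1 : ℝ) 1 → Square := fun t => ⟨!₂[(t : ℝ), y.1 1], by
    intro j
    fin_cases j
    · exact t.2
    · exact y.2 1⟩
  have hp : Continuous p := by
    refine Continuous.subtype_mk ?_ _
    refine (PiLp.continuous_toLp 2 _).comp (continuous_pi fun j => ?_)
    fin_cases j
    · exact continuous_subtype_val
    · exact continuous_const
  let q : ℝ → ℝ := fun t => Set.IccExtend (by norm_num : (-1 : ℝ) ≤ 1)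
    (fun t => (t : ℝ) + u (p t)) t
  have hq : Continuous q := (continuous_subtype_val.add (hu.comp hp)).Icc_extend'
  have hedge : ∀ t : Set.Icc (-1 : ℝ) 1, |(t : ℝ)| = 1 → u (p t) = 0 := by
    intro t ht
    have := hu1 (p t)
    have h0 := hu0 (p t)
    simp only [p, Matrix.cons_val_zero, ht] at this h0 ⊢
    linarith
  have hl : q (-1) = -1 := by
    simp only [q, Set.IccExtend_left]
    rw [hedge _ (by simp)]
    simp
  have hr : q 1 = 1 := by
    simp only [q, Set.IccExtend_right]
    rw [hedge _ (by simp)]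
    simp
  obtain ⟨t, ht, hty⟩ := intermediate_value_Icc (by norm_num : (-1 : ℝ) ≤ 1) hq.continuousOn
    (by rw [hl, hr]; exact y.2 0)
  refine ⟨p ⟨t, ht⟩, Subtype.ext ?_⟩
  simp only [q, Set.IccExtend_of_mem _ _ ht] at hty
  ext j
  fin_cases j
  · simpa [horizontalShift, p] using hty
  · simp [horizontalShift, p]

lemma continuous_of_abs_sub_le (hlip : ∀ x y : Square, |u x - u y| ≤ 1 / 2 * dist x y) :
    Continuous u :=
  (LipschitzWith.of_dist_le_mul (K := 1 / 2) fun x y => by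
    simpa [Real.dist_eq] using hlip x y).continuous

lemma horizontalShift_mem_invLip (hlip : ∀ x y, |u x - u y| ≤ 1 / 2 * dist x y) :
    horizontalShift u hu0 hu1 ∈ invLip := by
  have hbi := isBiLipschitz_horizontalShift hu0 hu1 hlip
  refine ⟨Function.bijective_iff_existsUnique _ |>.1 ⟨fun x y hxy => ?_,
    horizontalShift_surjective hu0 hu1 (continuous_of_abs_sub_le hlip)⟩, hbi⟩
  obtain ⟨L, hL, h⟩ := hbi
  have h1 := (h x y).1
  rw [hxy, dist_self] at h1
  have h2 : dist x y ≤ 0 := by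
    by_contra! hc
    exact absurd h1 (not_le.2 (by positivity))
  exact dist_le_zero.1 h2

lemma measurable_horizontalShift (hu : Measurable u) :
    Measurable (horizontalShift u hu0 hu1) := by
  refine Measurable.subtype_mk (measurable_subtype_coe.add ?_)
  exact measurable_toPlane.comp (hu.prodMk measurable_const)

end Shift

/-! ### Grid and pyramids -/

/-- The midpoints of the `m` intervals of length `2 / m` that partition `[-1, 1]`. -/
noncomputable def gridCenter (m : ℕ) (a : Fin m) : ℝ := -1 + (2 * (a : ℝ) + 1) / m

/-- The pyramid of height `1 / m` on a cell of the grid. -/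
noncomputable def bump (m : ℕ) (i : Fin 2 → Fin m) (x : Square) : ℝ :=
  max 0 (1 / m - max |x.1 0 - gridCenter m (i 0)| |x.1 1 - gridCenter m (i 1)|)

lemma bump_nonneg (m : ℕ) (i : Fin 2 → Fin m) (x : Square) : 0 ≤ bump m i x := le_max_left _ _

lemma bump_le (m : ℕ) (i : Fin 2 → Fin m) (x : Square) : bump m i x ≤ 1 / m := by
  refine max_le (by positivity) ?_
  linarith [(abs_nonneg _).trans
    (le_max_left |x.1 0 - gridCenter m (i 0)| |x.1 1 - gridCenter m (i 1)|)]

lemma bump_le_add_dist (m : ℕ) (i : Fin 2 → Fin m) (x y : Square) :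
    bump m i x ≤ bump m i y + dist x y := by
  have hd : 0 ≤ dist x y := dist_nonneg
  refine max_le (add_nonneg (bump_nonneg m i y) hd) ?_
  have h : ∀ j, |y.1 j - gridCenter m (i j)| ≤ |x.1 j - gridCenter m (i j)| + dist x y := by
    intro j
    have h1 := abs_sub_le (y.1 j) (x.1 j) (gridCenter m (i j))
    have h2 := abs_coord_sub_le x y j
    rw [abs_sub_comm] at h2
    linarith
  have h3 : max |y.1 0 - gridCenter m (i 0)| |y.1 1 - gridCenter m (i 1)|
      ≤ max |x.1 0 - gridCenter m (i 0)| |x.1 1 - gridCenter m (i 1)| + dist x y :=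
    max_le ((h 0).trans (by gcongr; exact le_max_left _ _))
      ((h 1).trans (by gcongr; exact le_max_right _ _))
  have h4 : 1 / m - max |y.1 0 - gridCenter m (i 0)| |y.1 1 - gridCenter m (i 1)|
      ≤ bump m i y := le_max_right _ _
  linarith

lemma abs_gridCenter_add_le (m : ℕ) (a : Fin m) : |gridCenter m a| + 1 / m ≤ 1 := by
  have hm : (0 : ℝ) < m := by exact_mod_cast a.pos
  have ha : (a : ℝ) + 1 ≤ m := by exact_mod_cast a.isLt
  have ha0 : (0 : ℝ) ≤ a := by positivity
  have h : |gridCenter m a| ≤ 1 - 1 / m := by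
    have e : gridCenter m a = (2 * a + 1 - m) / m := by
      unfold gridCenter
      field_simp
      ring
    have e2 : (1 : ℝ) - 1 / m = (m - 1) / m := by field_simp
    rw [e, e2, abs_div, abs_of_pos hm]
    gcongr
    rw [abs_le]
    constructor <;> linarith
  linarith

/-- The cell lies inside the square and the pyramid has slope one. This keeps shifted points in the
square and fixes the vertical edges. -/
lemma bump_le_one_sub_abs (m : ℕ) (i : Fin 2 → Fin m) (x : Square) :
    bump m i x ≤ 1 - |x.1 0| := by
  refine max_le (sub_nonneg.2 (abs_le.2 (x.2 0))) ?_
  have h1 := abs_gridCenter_add_le m (i 0)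
  have h2 := le_max_left |x.1 0 - gridCenter m (i 0)| |x.1 1 - gridCenter m (i 1)|
  have h3 := abs_sub_abs_le_abs_sub (x.1 0) (gridCenter m (i 0))
  linarith

lemma two_div_le_abs_gridCenter_sub {m : ℕ} {a b : Fin m} (hab : a ≠ b) :
    2 / (m : ℝ) ≤ |gridCenter m a - gridCenter m b| := by
  have hm : (0 : ℝ) < m := by exact_mod_cast a.pos
  have e : gridCenter m a - gridCenter m b = 2 * ((a : ℝ) - b) / m := by
    unfold gridCenter
    field_simp
    ring
  have h : (1 : ℝ) ≤ |(a : ℝ) - b| := by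
    have h1 : (1 : ℤ) ≤ |(a : ℤ) - b| := by
      refine Int.one_le_abs ?_
      intro h
      exact hab (Fin.ext (by omega))
    exact_mod_cast h1
  rw [e, abs_div, abs_of_pos hm, abs_mul, abs_two]
  gcongr
  linarith

lemma abs_sub_lt_of_bump_pos {m : ℕ} {i : Fin 2 → Fin m} {x : Square} (h : 0 < bump m i x)
    (j : Fin 2) : |x.1 j - gridCenter m (i j)| < 1 / m := by
  have h1 : 0 < 1 / (m : ℝ) - max |x.1 0 - gridCenter m (i 0)| |x.1 1 - gridCenter m (i 1)| := by
    simpa [bump] using h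
  have h2 := sub_pos.1 h1
  fin_cases j
  · exact (le_max_left _ _).trans_lt h2
  · exact (le_max_right _ _).trans_lt h2

/-- In some coordinate the two centres are at least `2 / m` apart, whereas both pyramids being
positive puts `x` strictly within `1 / m` of each. -/
lemma bump_eq_zero_of_ne {m : ℕ} {i k : Fin 2 → Fin m} (hik : i ≠ k) {x : Square}
    (h : 0 < bump m i x) : bump m k x = 0 := by
  by_contra hne
  have hk : 0 < bump m k x := lt_of_le_of_ne (bump_nonneg m k x) (Ne.symm hne)
  obtain ⟨j, hj⟩ := Function.ne_iff.1 hik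
  have h1 := two_div_le_abs_gridCenter_sub hj
  have h2 := abs_sub_lt_of_bump_pos h j
  have h3 := abs_sub_lt_of_bump_pos hk j
  have h4 := abs_sub_le (gridCenter m (i j)) (x.1 j) (gridCenter m (k j))
  rw [abs_sub_comm (gridCenter m (i j)) (x.1 j)] at h4
  have h5 : 2 / (m : ℝ) = 1 / m + 1 / m := by ring
  linarith

/-! ### Displacements indexed by selections of cells -/

/-- The displacement given by the bumps on those cells of `G` that `θ` selects. -/
noncomputable def displacement {m : ℕ} (G : Finset (Fin 2 → Fin m)) (θ : G → Bool)
    (x : Square) : ℝ :=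
  1 / 2 * ⨆ i : G, if θ i then bump m i x else 0

section Displacement

variable {m : ℕ} (G : Finset (Fin 2 → Fin m)) (θ : G → Bool)

lemma displacement_nonneg (x : Square) : 0 ≤ displacement G θ x := by
  refine mul_nonneg (by norm_num) (Real.iSup_nonneg fun i => ?_)
  split_ifs
  · exact bump_nonneg _ _ _
  · exact le_rfl

lemma displacement_le {b : ℝ} (hb : 0 ≤ b) {x : Square} (h : ∀ i, bump m i x ≤ b) :
    displacement G θ x ≤ b / 2 := by
  have : (⨆ i : G, if θ i then bump m i x else 0) ≤ b := by
    refine Real.iSup_le (fun i => ?_) hb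
    split_ifs
    · exact h i
    · exact hb
  unfold displacement
  linarith

lemma displacement_le_one_sub_abs (x : Square) : displacement G θ x ≤ 1 - |x.1 0| := by
  have h0 : 0 ≤ 1 - |x.1 0| := sub_nonneg.2 (abs_le.2 (x.2 0))
  have := displacement_le G θ h0 fun i => bump_le_one_sub_abs m i x
  linarith

lemma abs_displacement_le (x : Square) : |displacement G θ x| ≤ 1 / (2 * m) := by
  rw [abs_of_nonneg (displacement_nonneg G θ x)]
  refine (displacement_le G θ (by positivity) fun i => bump_le m i x).trans (le_of_eq ?_)
  ring

/-- A supremum of 1-Lipschitz functions is 1-Lipschitz, whatever the number of cells; a supremum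
thus avoids the case analysis a sum would need, and agrees with it because at most one bump is
positive at a point. -/
lemma displacement_sub_le (x y : Square) :
    displacement G θ x - displacement G θ y ≤ 1 / 2 * dist x y := by
  have hd : 0 ≤ dist x y := dist_nonneg
  have h : (⨆ i : G, if θ i then bump m i x else 0)
      ≤ (⨆ i : G, if θ i then bump m i y else 0) + dist x y := by
    have hb : ∀ i : G, (if θ i then bump m i y else 0)
        ≤ ⨆ i : G, if θ i then bump m i y else 0 :=
      fun i => le_ciSup (f := fun i : G => if θ i then bump m i y else 0)
        (Set.finite_range _).bddAbove i
    -- `Real.iSup_le` needs a nonnegative bound, since a supremum over an empty `G` is `0`.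
    have hn : 0 ≤ ⨆ i : G, if θ i then bump m i y else 0 := by
      have := displacement_nonneg G θ y
      unfold displacement at this
      linarith
    refine Real.iSup_le (fun i => ?_) (by positivity)
    have hi := hb i
    split_ifs at hi ⊢
    · linarith [bump_le_add_dist m i x y]
    · linarith
  unfold displacement
  linarith

lemma abs_displacement_sub_le (x y : Square) :
    |displacement G θ x - displacement G θ y| ≤ 1 / 2 * dist x y := by
  refine abs_sub_le_iff.2 ⟨displacement_sub_le G θ x y, ?_⟩
  rw [dist_comm]
  exact displacement_sub_le G θ y x

lemma displacement_eq {i : G} {x : Square} (h : 0 < bump m i x) :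
    displacement G θ x = if θ i then bump m i x / 2 else 0 := by
  have hs : (⨆ k : G, if θ k then bump m k x else 0) = if θ i then bump m i x else 0 := by
    have hk : ∀ k : G, k ≠ i → (if θ k then bump m k x else 0) = 0 := by
      intro k hk
      rw [bump_eq_zero_of_ne (fun h => hk (Subtype.ext h.symm)) h, ite_self]
    have hi : 0 ≤ if θ i then bump m i x else 0 := by
      split_ifs
      · exact h.le
      · exact le_rfl
    refine le_antisymm (Real.iSup_le (fun k => ?_) hi)
      (le_ciSup (f := fun i : G => if θ i then bump m i x else 0)
        (Set.finite_range _).bddAbove i)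
    by_cases hki : k = i
    · rw [hki]
    · rw [hk k hki]
      exact hi
  rw [displacement, hs]
  split_ifs <;> ring

end Displacement

/-! ### Cells charged by `PX` -/

lemma volume_box (a b : Fin 2 → ℝ) :
    volume {x : Plane | ∀ j, x j ∈ Set.Icc (a j) (b j)} = ∏ j, ENNReal.ofReal (b j - a j) := by
  have h : {x : Plane | ∀ j, x j ∈ Set.Icc (a j) (b j)} = WithLp.ofLp ⁻¹' Set.Icc a b := by
    ext x
    simp [Set.mem_Icc, Pi.le_def, forall_and]
  rw [h, (PiLp.volume_preserving_ofLp (Fin 2)).measure_preimage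
    measurableSet_Icc.nullMeasurableSet, Real.volume_Icc_pi]

lemma measurableSet_squareSet : MeasurableSet squareSet := by
  have : squareSet = ⋂ j, (fun x : Plane => x j) ⁻¹' Set.Icc (-1) 1 := by
    ext x
    simp [squareSet]
  rw [this]
  exact MeasurableSet.iInter fun j =>
    (by fun_prop : Measurable fun x : Plane => x j) measurableSet_Icc

lemma lebesgueSquare_univ : lebesgueSquare Set.univ = 4 := by
  rw [lebesgueSquare, comap_subtype_coe_apply measurableSet_squareSet, Set.image_univ,
    Subtype.range_coe, squareSet, volume_box]
  simp only [Fin.prod_univ_two]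
  rw [← ENNReal.ofReal_mul (by norm_num)]
  norm_num

instance isFiniteMeasure_lebesgueSquare : IsFiniteMeasure lebesgueSquare :=
  ⟨by rw [lebesgueSquare_univ]; norm_num⟩

/-- The concentric closed subsquare, shrunk by the factor `1 - ε`, of a cell of the grid. -/
def innerCell (m : ℕ) (ε : ℝ) (i : Fin 2 → Fin m) : Set Square :=
  {x | ∀ j, |x.1 j - gridCenter m (i j)| ≤ (1 - ε) / m}

section InnerCell

variable {m : ℕ} {ε : ℝ}

lemma measurableSet_innerCell (i : Fin 2 → Fin m) : MeasurableSet (innerCell m ε i) := by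
  unfold innerCell
  measurability

lemma le_bump_of_mem_innerCell {i : Fin 2 → Fin m} {x : Square} (hx : x ∈ innerCell m ε i) :
    ε / m ≤ bump m i x := by
  refine le_max_of_le_right ?_
  have h := max_le (hx 0) (hx 1)
  rw [sub_div] at h
  linarith

lemma pairwise_disjoint_innerCell (hε : 0 < ε) :
    Pairwise (Function.onFun Disjoint (innerCell m ε)) := by
  intro i k hik
  refine Set.disjoint_left.2 fun x hi hk => ?_
  have hm : (0 : ℝ) < m := by exact_mod_cast (i 0).pos
  have h : 0 < ε / m := by positivity
  have h1 := bump_eq_zero_of_ne hik (h.trans_le (le_bump_of_mem_innerCell hi))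
  have h2 := le_bump_of_mem_innerCell hk
  linarith

lemma lebesgueSquare_real_innerCell (hε : 0 ≤ ε) (hε1 : ε ≤ 1) (i : Fin 2 → Fin m) :
    lebesgueSquare.real (innerCell m ε i) = (2 * (1 - ε) / m) ^ 2 := by
  have hm : (0 : ℝ) < m := by exact_mod_cast (i 0).pos
  have hle : (1 - ε) / m ≤ 1 / m := by
    gcongr
    linarith
  have h0 : 0 ≤ (1 - ε) / m := div_nonneg (by linarith) hm.le
  have h : Subtype.val '' innerCell m ε i = {x : Plane | ∀ j, x j ∈
      Set.Icc (gridCenter m (i j) - (1 - ε) / m) (gridCenter m (i j) + (1 - ε) / m)} := by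
    ext x
    constructor
    · rintro ⟨y, hy, rfl⟩ j
      have := abs_le.1 (hy j)
      exact ⟨by linarith [this.1], by linarith [this.2]⟩
    · intro hx
      have hsq : x ∈ squareSet := by
        intro j
        have h1 := hx j
        have h2 := abs_gridCenter_add_le m (i j)
        have h3 := abs_le.1 (le_refl |gridCenter m (i j)|)
        exact ⟨by linarith [h1.1, h3.1], by linarith [h1.2, h3.2]⟩
      refine ⟨⟨x, hsq⟩, fun j => abs_le.2 ?_, rfl⟩
      have h1 := hx j
      exact ⟨by linarith [h1.1], by linarith [h1.2]⟩
  rw [Measure.real, lebesgueSquare, comap_subtype_coe_apply measurableSet_squareSet, h, volume_box]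
  simp only [Fin.prod_univ_two, add_sub_sub_cancel]
  rw [ENNReal.toReal_mul, ENNReal.toReal_ofReal (by linarith)]
  ring

end InnerCell

/-- The density of `μ` is integrable, so its integral over sets of small `ν`-measure is uniformly
small. -/
lemma exists_pos_measureReal_le {α : Type*} [MeasurableSpace α] {μ ν : Measure α}
    [IsFiniteMeasure μ] [IsFiniteMeasure ν] (h : μ ≪ ν) {c : ℝ} (hc : 0 < c) :
    ∃ δ : ℝ, 0 < δ ∧ ∀ s, MeasurableSet s → ν.real s < δ → μ.real s ≤ c := by
  obtain ⟨δ, hδ, H⟩ := exists_pos_setLIntegral_lt_of_measure_lt (μ := ν) (f := μ.rnDeriv ν)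
    (by rw [Measure.lintegral_rnDeriv h]; exact measure_ne_top _ _)
    (ε := ENNReal.ofReal c) (by simpa using hc)
  refine ⟨(min δ 1).toReal, ENNReal.toReal_pos (by simp [hδ.ne']) (by simp), fun s hs hlt => ?_⟩
  have h1 : ν s < min δ 1 := (ENNReal.toReal_lt_toReal (measure_ne_top _ _) (by simp)).1 hlt
  have h2 := H s (h1.trans_le (min_le_left _ _))
  rw [Measure.setLIntegral_rnDeriv h] at h2
  exact ENNReal.toReal_le_of_le_ofReal hc.le h2.le

/-- For every grid, a positive fraction of its cells have comparable mass in their interior. -/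
lemma exists_good_cells (PX : Measure Square) [IsProbabilityMeasure PX]
    (hPX : PX ≪ lebesgueSquare) :
    ∃ ε : ℝ, 0 < ε ∧ ∃ γ : ℝ, 0 < γ ∧ ∀ m : ℕ, 1 ≤ m → ∃ G : Finset (Fin 2 → Fin m),
      γ * m ^ 2 ≤ G.card ∧ ∀ i ∈ G, 1 / (4 * (m : ℝ) ^ 2) ≤ PX.real (innerCell m ε i) := by
  classical
  obtain ⟨δ, hδ, hac⟩ := exists_pos_measureReal_le hPX (c := 1 / 4) (by norm_num)
  -- The inner cells miss area `4 - 4 * (1 - ε) ^ 2 ≤ 8 * ε ≤ δ / 2`, for every `m`.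
  set ε : ℝ := min (1 / 2) (δ / 16)
  have hε : 0 < ε := by positivity
  have hε1 : ε ≤ 1 / 2 := min_le_left _ _
  have hε2 : ε ≤ δ / 16 := min_le_right _ _
  refine ⟨ε, hε, δ / 4, by positivity, fun m hm => ?_⟩
  have hm0 : (0 : ℝ) < m := by exact_mod_cast hm
  have hcell : ∀ i : Fin 2 → Fin m,
      lebesgueSquare.real (innerCell m ε i) = (2 * (1 - ε) / m) ^ 2 :=
    lebesgueSquare_real_innerCell hε.le (by linarith)
  have hmeas : MeasurableSet (⋃ i, innerCell m ε i) := MeasurableSet.iUnion measurableSet_innerCell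
  have hcard : ((Finset.univ : Finset (Fin 2 → Fin m)).card : ℝ) = (m : ℝ) ^ 2 := by simp
  have h1 : lebesgueSquare.real (⋃ i, innerCell m ε i)ᶜ < δ := by
    rw [measureReal_compl hmeas, measureReal_iUnion_fintype (pairwise_disjoint_innerCell hε)
      measurableSet_innerCell]
    simp_rw [hcell]
    have h4 : lebesgueSquare.real Set.univ = 4 := by simp [Measure.real, lebesgueSquare_univ]
    rw [h4, Finset.sum_const, nsmul_eq_mul, hcard]
    have : (m : ℝ) ^ 2 * (2 * (1 - ε) / m) ^ 2 = 4 * (1 - ε) ^ 2 := by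
      field_simp
      ring
    rw [this]
    nlinarith [sq_nonneg ε]
  have h2 : 3 / 4 ≤ PX.real (⋃ i, innerCell m ε i) := by
    have := hac _ hmeas.compl h1
    rw [probReal_compl_eq_one_sub hmeas] at this
    linarith
  set G : Finset (Fin 2 → Fin m) :=
    Finset.univ.filter fun i => 1 / (4 * (m : ℝ) ^ 2) ≤ PX.real (innerCell m ε i)
  refine ⟨G, ?_, fun i hi => (Finset.mem_filter.1 hi).2⟩
  have h3 : PX.real (⋃ i ∈ Gᶜ, innerCell m ε i) ≤ 1 / 4 := by
    calc PX.real (⋃ i ∈ Gᶜ, innerCell m ε i) ≤ ∑ i ∈ Gᶜ, PX.real (innerCell m ε i) :=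
          measureReal_biUnion_finset_le _ _
      _ ≤ ∑ _i ∈ Gᶜ, 1 / (4 * (m : ℝ) ^ 2) := by
          refine Finset.sum_le_sum fun i hi => ?_
          simp only [G, Finset.compl_filter, Finset.mem_filter, Finset.mem_univ, true_and,
            not_le] at hi
          exact hi.le
      _ ≤ ∑ _i : Fin 2 → Fin m, 1 / (4 * (m : ℝ) ^ 2) :=
          Finset.sum_le_sum_of_subset_of_nonneg (Finset.subset_univ _)
            fun _ _ _ => by positivity
      _ = 1 / 4 := by
          rw [Finset.sum_const, nsmul_eq_mul, hcard]
          field_simp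
  have h4 : PX.real (⋃ i, innerCell m ε i)
      ≤ PX.real (⋃ i ∈ G, innerCell m ε i) + PX.real (⋃ i ∈ Gᶜ, innerCell m ε i) := by
    refine (measureReal_mono ?_).trans (measureReal_union_le _ _)
    intro x hx
    obtain ⟨i, hi⟩ := Set.mem_iUnion.1 hx
    by_cases hG : i ∈ G
    · exact Or.inl (Set.mem_biUnion hG hi)
    · exact Or.inr (Set.mem_biUnion (Finset.mem_compl.2 hG) hi)
  -- The good cells carry mass at least `3 / 4 - 1 / 4`, above the `1 / 4` allowed to sets of area
  -- below `δ`. As each inner cell has area at most `4 / m ^ 2`, there must be many of them.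
  have h5 : δ ≤ lebesgueSquare.real (⋃ i ∈ G, innerCell m ε i) := by
    by_contra! hlt
    have := hac _ (Finset.measurableSet_biUnion _ fun i _ => measurableSet_innerCell i) hlt
    linarith
  have h6 : lebesgueSquare.real (⋃ i ∈ G, innerCell m ε i) ≤ G.card * (4 / (m : ℝ) ^ 2) := by
    refine (measureReal_biUnion_finset_le _ _).trans ?_
    simp_rw [hcell]
    rw [Finset.sum_const, nsmul_eq_mul]
    gcongr
    rw [div_pow]
    gcongr
    nlinarith
  have h7 := h5.trans h6
  rw [mul_div_assoc', le_div_iff₀ (by positivity)] at h7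
  linarith

/-! ### Separation of the maps and the lower bound on risk -/

lemma measurable_ofReal_abs_coord_sub_sq {α : Type*} [MeasurableSpace α] {g h : α → Plane}
    (hg : Measurable g) (hh : Measurable h) (j : Fin 2) :
    Measurable fun x => ENNReal.ofReal (|g x j - h x j| ^ 2) := by
  simp_rw [sq_abs]
  fun_prop

/-- The regression function indexed by a selection of cells. -/
noncomputable def cellShift {m : ℕ} (G : Finset (Fin 2 → Fin m)) (θ : G → Bool) :
    Square → Square :=
  horizontalShift (displacement G θ) (displacement_nonneg G θ) (displacement_le_one_sub_abs G θ)

section CellShift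

variable {m : ℕ} (G : Finset (Fin 2 → Fin m)) (θ : G → Bool)

lemma cellShift_mem_invLip : cellShift G θ ∈ invLip :=
  horizontalShift_mem_invLip _ _ (abs_displacement_sub_le G θ)

lemma measurable_displacement : Measurable (displacement G θ) :=
  (continuous_of_abs_sub_le (abs_displacement_sub_le G θ)).measurable

lemma measurable_cellShift : Measurable (cellShift G θ) :=
  measurable_horizontalShift _ _ (measurable_displacement G θ)

/-- Pointwise `(a - b) ^ 2 ≤ 2 * (g - a) ^ 2 + 2 * (g - b) ^ 2` in the first coordinate, the only
one in which the maps differ. -/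
lemma lintegral_displacement_sub_sq_le (PX : Measure Square) (θ' : G → Bool)
    {g : Square → Plane} (hg : Measurable g) :
    ∫⁻ x, ENNReal.ofReal ((displacement G θ x - displacement G θ' x) ^ 2) ∂PX
      ≤ 2 * risk PX g (cellShift G θ) + 2 * risk PX g (cellShift G θ') := by
  have hle : ∀ τ : G → Bool,
      ∫⁻ x, ENNReal.ofReal (|g x 0 - (cellShift G τ x : Plane) 0| ^ 2) ∂PX
        ≤ risk PX g (cellShift G τ) := by
    intro τ
    unfold risk
    rw [Fin.sum_univ_two]
    exact le_self_add
  have hm : ∀ τ : G → Bool, Measurable fun x =>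
      ENNReal.ofReal (|g x 0 - (cellShift G τ x : Plane) 0| ^ 2) := by
    intro τ
    exact measurable_ofReal_abs_coord_sub_sq hg
      (measurable_subtype_coe.comp (measurable_cellShift G τ)) 0
  calc _ ≤ ∫⁻ x, (2 * ENNReal.ofReal (|g x 0 - (cellShift G θ x : Plane) 0| ^ 2)
        + 2 * ENNReal.ofReal (|g x 0 - (cellShift G θ' x : Plane) 0| ^ 2)) ∂PX := by
        refine lintegral_mono fun x => ?_
        have h2 : ∀ a : ℝ, 2 * ENNReal.ofReal a = ENNReal.ofReal (2 * a) := by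
          simp [ENNReal.ofReal_mul]
        rw [h2, h2, ← ENNReal.ofReal_add (by positivity) (by positivity)]
        refine ENNReal.ofReal_le_ofReal ?_
        have e : ∀ τ : G → Bool, (cellShift G τ x : Plane) 0 = x.1 0 + displacement G τ x := by
          intro τ
          simp [cellShift, horizontalShift]
        rw [sq_abs, sq_abs, e, e]
        nlinarith [sq_nonneg ((g x 0 - (x.1 0 + displacement G θ x))
          + (g x 0 - (x.1 0 + displacement G θ' x)))]
    _ = 2 * ∫⁻ x, ENNReal.ofReal (|g x 0 - (cellShift G θ x : Plane) 0| ^ 2) ∂PX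
        + 2 * ∫⁻ x, ENNReal.ofReal (|g x 0 - (cellShift G θ' x : Plane) 0| ^ 2) ∂PX := by
        rw [lintegral_add_left ((hm θ).const_mul 2), lintegral_const_mul _ (hm θ),
          lintegral_const_mul _ (hm θ')]
    _ ≤ _ := by
        gcongr
        · exact hle θ
        · exact hle θ'

/-- On the inner cell of each disagreement one displacement is at least `ε / (2 * m)` and the other
is zero; these cells are disjoint. -/
lemma hammingDist_mul_le (PX : Measure Square) [IsFiniteMeasure PX] (θ' : G → Bool) {ε w : ℝ}
    (hε : 0 < ε) (hw : ∀ i ∈ G, w ≤ PX.real (innerCell m ε i)) :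
    ENNReal.ofReal (hammingDist θ θ' * ((ε / (2 * m)) ^ 2 * w))
      ≤ ∫⁻ x, ENNReal.ofReal ((displacement G θ x - displacement G θ' x) ^ 2) ∂PX := by
  classical
  set S : Finset G := Finset.univ.filter fun i => θ i ≠ θ' i
  have hdisj : (S : Set G).PairwiseDisjoint fun i => innerCell m ε i.1 :=
    fun i _ k _ hik => pairwise_disjoint_innerCell hε fun h => hik (Subtype.ext h)
  calc ENNReal.ofReal (hammingDist θ θ' * ((ε / (2 * m)) ^ 2 * w))
      = ∑ _i ∈ S, ENNReal.ofReal ((ε / (2 * m)) ^ 2 * w) := by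
        rw [Finset.sum_const, nsmul_eq_mul, ENNReal.ofReal_mul (by positivity),
          ENNReal.ofReal_natCast]
        rfl
    _ ≤ ∑ i ∈ S, ∫⁻ x in innerCell m ε i.1,
          ENNReal.ofReal ((displacement G θ x - displacement G θ' x) ^ 2) ∂PX := by
        refine Finset.sum_le_sum fun i hi => ?_
        have hm : (0 : ℝ) < m := by exact_mod_cast (i.1 0).pos
        have hne : θ i ≠ θ' i := (Finset.mem_filter.1 hi).2
        calc ENNReal.ofReal ((ε / (2 * m)) ^ 2 * w)
            ≤ ENNReal.ofReal ((ε / (2 * m)) ^ 2) * PX (innerCell m ε i.1) := by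
              rw [ENNReal.ofReal_mul (by positivity)]
              gcongr
              exact ENNReal.ofReal_le_of_le_toReal (hw i.1 i.2)
          _ = ∫⁻ _ in innerCell m ε i.1, ENNReal.ofReal ((ε / (2 * m)) ^ 2) ∂PX := by
              rw [setLIntegral_const]
          _ ≤ _ := by
              refine setLIntegral_mono' (measurableSet_innerCell _) fun x hx => ?_
              refine ENNReal.ofReal_le_ofReal ?_
              have hb := le_bump_of_mem_innerCell hx
              have hpos : 0 < bump m i.1 x := lt_of_lt_of_le (by positivity) hb
              have hsq : (ε / (2 * m)) ^ 2 ≤ (bump m i.1 x / 2) ^ 2 := by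
                have : ε / (2 * m) = ε / m / 2 := by ring
                rw [this]
                gcongr
              rw [displacement_eq G θ hpos, displacement_eq G θ' hpos]
              cases h1 : θ i <;> cases h2 : θ' i <;> simp_all
    _ = ∫⁻ x in ⋃ i ∈ S, innerCell m ε i.1,
          ENNReal.ofReal ((displacement G θ x - displacement G θ' x) ^ 2) ∂PX :=
        (lintegral_biUnion_finset hdisj (fun i _ => measurableSet_innerCell i.1) _).symm
    _ ≤ _ := setLIntegral_le_lintegral _ _

lemma measurable_risk (PX : Measure Square) [SFinite PX] {n : ℕ} (fbar : Estimator n)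
    {f : Square → Square} (hf : Measurable f) :
    Measurable fun D => risk PX (fbar.1 D) f := by
  refine Finset.measurable_sum _ fun j _ => ?_
  have h : Measurable fun p : (Fin n → Square × Plane) × Square =>
      ENNReal.ofReal (|fbar.1 p.1 p.2 j - (f p.2 : Plane) j| ^ 2) :=
    measurable_ofReal_abs_coord_sub_sq fbar.2
      (measurable_subtype_coe.comp (hf.comp measurable_snd)) j
  exact h.lintegral_prod_right'

/-- Every estimator has large risk with large probability at some map indexed by the cells. -/
lemma exists_cellShift_sampleLaw_ge (PX : Measure Square) [IsProbabilityMeasure PX] {σ : ℝ}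
    (hσ : 0 < σ) {n : ℕ} (fbar : Estimator n) {ε w : ℝ} (hε : 0 < ε) (hw0 : 0 < w) (hm : 1 ≤ m)
    (hw : ∀ i ∈ G, w ≤ PX.real (innerCell m ε i))
    (hexp : Real.exp ((1 / (2 * m)) ^ 2 / σ ^ 2) ^ n * (9 / 10) ^ G.card ≤ 1 / 16) :
    ∃ θ : G → Bool, 3 / 4 ≤ sampleLaw PX σ n (cellShift G θ)
      {D | ENNReal.ofReal ((ε / (2 * m)) ^ 2 * w * G.card / 16)
        ≤ risk PX (fbar.1 D) (cellShift G θ)} := by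
  classical
  -- Two risks below `s` bound the separation by `4 * s`; the factor `16` then makes the Hamming
  -- distance at most `G.card / 4`.
  set s : ℝ := (ε / (2 * m)) ^ 2 * w * G.card / 16
  have hm0 : (0 : ℝ) < m := by exact_mod_cast hm
  have := isProbabilityMeasure_obsLaw PX σ measurable_id
  set A : (G → Bool) → Set (Fin n → Square × Plane) :=
    fun θ => {D | risk PX (fbar.1 D) (cellShift G θ) < ENNReal.ofReal s}
  have hA : ∀ θ, MeasurableSet (A θ) := fun θ =>
    measurableSet_lt (measurable_risk PX fbar (measurable_cellShift G θ)) measurable_const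
  obtain ⟨θ, hθ⟩ := exists_measure_le_of_hammingDist
    (Measure.pi fun _ : Fin n => obsLaw PX σ id) A hA (by
      intro D θ θ' h h'
      have hg : Measurable (fbar.1 D) := fbar.2.comp measurable_prodMk_left
      have h1 := (hammingDist_mul_le G θ PX θ' hε hw).trans
        (lintegral_displacement_sub_sq_le G θ PX θ' hg)
      have h2 : 2 * risk PX (fbar.1 D) (cellShift G θ) + 2 * risk PX (fbar.1 D) (cellShift G θ')
          ≤ ENNReal.ofReal (4 * s) := by
        have e : ENNReal.ofReal (4 * s) = 2 * ENNReal.ofReal s + 2 * ENNReal.ofReal s := by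
          rw [ENNReal.ofReal_mul (by norm_num), ← add_mul]
          norm_num
        rw [e]
        gcongr
        · exact le_of_lt h
        · exact le_of_lt h'
      have h3 := (ENNReal.ofReal_le_ofReal_iff (by positivity)).1 (h1.trans h2)
      have hpos : 0 < (ε / (2 * m)) ^ 2 * w := by positivity
      have h4 : (4 * hammingDist θ θ' : ℝ) ≤ G.card := by
        refine le_of_mul_le_mul_right ?_ hpos
        simp only [s] at h3
        linarith
      rw [Fintype.card_coe]
      exact_mod_cast h4)
  refine ⟨θ, ?_⟩
  have hobs := obsLaw_eq_withDensity PX hσ (measurable_displacement G θ)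
    (measurable_cellShift G θ) fun x => rfl
  have hprob := isProbabilityMeasure_obsLaw PX σ (measurable_cellShift G θ)
  have hprob' : IsProbabilityMeasure
      ((obsLaw PX σ id).withDensity (likelihoodRatio σ (displacement G θ))) := hobs ▸ hprob
  have h1 : sampleLaw PX σ n (cellShift G θ) (A θ) ^ 2 ≤ (1 / 4) ^ 2 := by
    rw [sampleLaw, hobs]
    refine (pi_withDensity_sq_le _ (measurable_likelihoodRatio σ (measurable_displacement G θ))
      (lintegral_likelihoodRatio_sq_le PX hσ (measurable_displacement G θ)
        (abs_displacement_le G θ)) (hA θ)).trans ?_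
    calc _ ≤ ENNReal.ofReal (Real.exp ((1 / (2 * m)) ^ 2 / σ ^ 2)) ^ n
          * ENNReal.ofReal ((9 / 10) ^ G.card) := by
          rw [Fintype.card_coe] at hθ
          gcongr
      _ = ENNReal.ofReal (Real.exp ((1 / (2 * m)) ^ 2 / σ ^ 2) ^ n * (9 / 10) ^ G.card) := by
          rw [ENNReal.ofReal_mul (by positivity), ENNReal.ofReal_pow (Real.exp_pos _).le]
      _ ≤ ENNReal.ofReal ((1 / 4) ^ 2) := by
          refine ENNReal.ofReal_le_ofReal (hexp.trans ?_)
          norm_num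
      _ = (1 / 4) ^ 2 := by
          rw [ENNReal.ofReal_pow (by norm_num), ENNReal.ofReal_div_of_pos (by norm_num)]
          norm_num
  have h2 : sampleLaw PX σ n (cellShift G θ) (A θ) ≤ 1 / 4 :=
    (ENNReal.pow_le_pow_left_iff two_ne_zero).1 h1
  have hP : IsProbabilityMeasure (sampleLaw PX σ n (cellShift G θ)) := by
    unfold sampleLaw
    infer_instance
  have h3 : {D | ENNReal.ofReal s ≤ risk PX (fbar.1 D) (cellShift G θ)} = (A θ)ᶜ := by
    ext D
    simp [A]
  rw [h3, prob_compl_eq_one_sub (hA θ)]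
  have h4 : (3 / 4 : ℝ≥0∞) = 1 - 1 / 4 := by
    refine ENNReal.eq_sub_of_add_eq (by norm_num) ?_
    rw [← ENNReal.add_div]
    norm_num
    exact ENNReal.div_self (by norm_num) (by norm_num)
  rw [h4]
  gcongr

end CellShift

end InvertibleRegression

/-! ### Choice of the grid size -/

theorem theorem1 (σ : ℝ) (hσ : 0 < σ)
    (PX : Measure InvertibleRegression.Square) [IsProbabilityMeasure PX]
    (hdensity : PX ≪ InvertibleRegression.lebesgueSquare) (hsupport : PX.support = Set.univ) :
    ∃ C : ℝ, 0 < C ∧ ∀ n : ℕ, 1 ≤ n →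
      (1 / 2 : ℝ≥0∞) <
        ⨅ fbar : InvertibleRegression.Estimator n, ⨆ f ∈ InvertibleRegression.invLip,
          InvertibleRegression.sampleLaw PX σ n f
            {D | ENNReal.ofReal (C * (n : ℝ) ^ (-(2 : ℝ) / (2 + 2))) ≤
              InvertibleRegression.risk PX (fbar.1 D) f} := by
  obtain ⟨ε, hε, γ, hγ, hgood⟩ := InvertibleRegression.exists_good_cells PX hdensity
  -- The second term keeps the likelihood exponent below `γ * m ^ 2 / 20`, half of the gain `γ * m ^
  -- 2 / 10` from `(9 / 10) ^ G.card`; the third makes the remaining half at least `3`, and `exp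
  -- (-3) ≤ 1 / 16`.
  obtain ⟨A, hA⟩ := exists_nat_ge (1 + 5 / (γ * σ ^ 2) + 60 / γ)
  have hp1 : 0 < 5 / (γ * σ ^ 2) := by positivity
  have hp2 : 0 < 60 / γ := by positivity
  have hA1 : (1 : ℝ) ≤ A := by linarith
  have hA2 : 5 / (γ * σ ^ 2) ≤ (A : ℝ) ^ 4 := by
    have : (A : ℝ) ≤ A ^ 4 := le_self_pow₀ hA1 (by norm_num)
    linarith
  have hA3 : 60 / γ ≤ (A : ℝ) ^ 2 := by
    have : (A : ℝ) ≤ A ^ 2 := le_self_pow₀ hA1 (by norm_num)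
    linarith
  refine ⟨ε ^ 2 * γ / (1024 * A ^ 2), by positivity, fun n hn => ?_⟩
  have hn1 : (1 : ℝ) ≤ n := by exact_mod_cast hn
  -- `t = n ^ (1 / 4)`, and the grid size is `A * ⌈t⌉₊`; rounding costs at most a factor `2`, hence
  -- `1024 = 256 * 4` in the constant.
  set t : ℝ := Real.sqrt (Real.sqrt n)
  have ht1 : 1 ≤ t := by simp [t, hn1]
  have ht2 : t ^ 2 = Real.sqrt n := Real.sq_sqrt (Real.sqrt_nonneg _)
  have ht4 : t ^ 4 = n := by
    rw [show t ^ 4 = (t ^ 2) ^ 2 by ring, ht2, Real.sq_sqrt (by positivity)]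
  set q : ℕ := ⌈t⌉₊
  have hq1 : t ≤ q := Nat.le_ceil t
  have hq2 : (q : ℝ) ≤ 2 * t := by
    have := Nat.ceil_lt_add_one (zero_le_one.trans ht1)
    linarith
  have hq0 : (1 : ℝ) ≤ q := ht1.trans hq1
  obtain ⟨m, hm⟩ : ∃ m : ℕ, m = A * q := ⟨_, rfl⟩
  have hmq : (m : ℝ) = A * q := by exact_mod_cast hm
  have hm0 : (0 : ℝ) < m := by
    rw [hmq]
    positivity
  have hm1 : 1 ≤ m := by exact_mod_cast hm0
  obtain ⟨G, hG, hw⟩ := hgood m hm1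
  have hexp : Real.exp ((1 / (2 * m)) ^ 2 / σ ^ 2) ^ n * (9 / 10) ^ G.card ≤ 1 / 16 := by
    have h1 : (9 / 10 : ℝ) ^ G.card ≤ Real.exp (-(G.card / 10)) := by
      have : (9 / 10 : ℝ) ≤ Real.exp (-(1 / 10)) := by
        linarith [Real.add_one_le_exp (-(1 / 10 : ℝ))]
      calc (9 / 10 : ℝ) ^ G.card ≤ Real.exp (-(1 / 10)) ^ G.card := by gcongr
        _ = _ := by
          rw [← Real.exp_nat_mul]
          congr 1
          ring
    have h2 : n * ((1 / (2 * m)) ^ 2 / σ ^ 2) ≤ γ * (m : ℝ) ^ 2 / 20 := by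
      have e : n * ((1 / (2 * (m : ℝ))) ^ 2 / σ ^ 2) = n / (4 * m ^ 2 * σ ^ 2) := by
        field_simp
        ring
      rw [e, div_le_iff₀ (by positivity), hmq]
      have h3 : 5 ≤ (A : ℝ) ^ 4 * (γ * σ ^ 2) := (div_le_iff₀ (by positivity)).1 hA2
      have h4 : (n : ℝ) ≤ (q : ℝ) ^ 4 := by
        rw [← ht4]
        gcongr
      calc (n : ℝ) ≤ (q : ℝ) ^ 4 := h4
        _ = (q : ℝ) ^ 4 * 5 / 5 := by ring
        _ ≤ (q : ℝ) ^ 4 * ((A : ℝ) ^ 4 * (γ * σ ^ 2)) / 5 := by gcongr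
        _ = _ := by ring
    have h5 : 3 ≤ γ * (m : ℝ) ^ 2 / 20 := by
      have h6 : 60 ≤ (A : ℝ) ^ 2 * γ := (div_le_iff₀ hγ).1 hA3
      have h7 : (1 : ℝ) ≤ (q : ℝ) ^ 2 := one_le_pow₀ hq0
      rw [hmq]
      nlinarith
    calc _ ≤ Real.exp (n * ((1 / (2 * m)) ^ 2 / σ ^ 2)) * Real.exp (-(G.card / 10)) := by
          rw [← Real.exp_nat_mul]
          gcongr
      _ = Real.exp (n * ((1 / (2 * m)) ^ 2 / σ ^ 2) + -(G.card / 10)) := (Real.exp_add _ _).symm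
      _ ≤ Real.exp (-3) := Real.exp_le_exp.2 (by linarith)
      _ ≤ 1 / 16 := by
          rw [Real.exp_neg, one_div]
          gcongr
          have h8 : Real.exp 3 = Real.exp 1 ^ 3 := by rw [← Real.exp_nat_mul]; norm_num
          rw [h8]
          have h9 := Real.exp_one_gt_d9
          calc (16 : ℝ) ≤ 2.7 ^ 3 := by norm_num
            _ ≤ _ := by
              gcongr
              linarith
  have hrate : ε ^ 2 * γ / (1024 * A ^ 2) * (n : ℝ) ^ (-(2 : ℝ) / (2 + 2))
      ≤ (ε / (2 * m)) ^ 2 * (1 / (4 * (m : ℝ) ^ 2)) * G.card / 16 := by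
    have h1 : (n : ℝ) ^ (-(2 : ℝ) / (2 + 2)) = 1 / t ^ 2 := by
      rw [ht2, Real.sqrt_eq_rpow, one_div, ← Real.rpow_neg (by positivity)]
      norm_num
    have h2 : (q : ℝ) ^ 2 ≤ 4 * t ^ 2 := by nlinarith
    rw [h1]
    calc ε ^ 2 * γ / (1024 * A ^ 2) * (1 / t ^ 2)
        = ε ^ 2 * γ / (256 * A ^ 2 * (4 * t ^ 2)) := by
          field_simp
          norm_num
      _ ≤ ε ^ 2 * γ / (256 * A ^ 2 * q ^ 2) := by gcongr
      _ = (ε / (2 * m)) ^ 2 * (1 / (4 * (m : ℝ) ^ 2)) * (γ * m ^ 2) / 16 := by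
          rw [hmq]
          field_simp
          norm_num
      _ ≤ _ := by gcongr
  -- The bound `3 / 4` is uniform over estimators, so the strict inequality survives the infimum.
  refine lt_of_lt_of_le (b := 3 / 4) ?_ (le_iInf fun fbar => ?_)
  · rw [ENNReal.lt_div_iff_mul_lt (by norm_num) (by norm_num)]
    have : (1 / 2 : ℝ≥0∞) * 4 = 2 := by
      rw [show (4 : ℝ≥0∞) = 2 * 2 by norm_num, ← mul_assoc, one_div,
        ENNReal.inv_mul_cancel (by norm_num) (by norm_num), one_mul]
    rw [this]
    norm_num
  · obtain ⟨θ, hθ⟩ := InvertibleRegression.exists_cellShift_sampleLaw_ge G PX hσ fbar hε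
      (w := 1 / (4 * (m : ℝ) ^ 2)) (by positivity) hm1 hw hexp
    refine hθ.trans (le_trans (measure_mono fun D hD => ?_)
      (le_iSup₂_of_le _ (InvertibleRegression.cellShift_mem_invLip G θ) le_rfl))
    exact (ENNReal.ofReal_le_ofReal hrate).trans hD
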